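/- Let $d\ge 1$, let $I$ be a countable (typically infinite) index set, and let $\Phi=\{\varphi_i\}_{i\in I}$ be a conformal iterated function system in $\mathbb{R}^d$ in the sense of Mauldin and Urbański, but without the cone condition. That is: (a) $X\subset\mathbb{R}^d$ is compact with $\operatorname{Int}X\neq\emptyset$, $V\subset\mathbb{R}^d$ is open and connected with $X\subset V$, and each $\varphi_i$ is a $C^1$ conformal diffeomorphism of $V$ onto a subset of $V$ with $\varphi_i(X)\subset X$. (b) Open set condition: $\varphi_i(\operatorname{Int}X)\subset\operatorname{Int}X$ for all $i\in I$, and $\varphi_i(\operatorname{Int}X)\cap\varphi_j(\operatorname{Int}X)=\emptyset$ for $i\ne j$. (c) Bounded distortion property: there is $K\ge1$ such that $|\varphi_\omega'(y)|\le K|\varphi_\omega'(x)|$ for all finite words $\omega$ over $I$ and all $x,y\in V$, where $\varphi_\omega=\varphi_{\omega_1}\circ\dots\circ\varphi_{\omega_n}$ for $\omega=\omega_1\cdots\omega_n$ and $|\cdot|$ is the operator norm of the derivative. Suppose that there is $s<1$ such that $|\varphi_i'(x)|\le s$ for all $i\in I$ and all $x\in X$ (this is assumed instead of the cone condition; no contraction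 beyond this bound is required). Let $$J(\Phi)=\bigcup_{\omega\in I^{\mathbb{N}}}\ \bigcap_{n\ge 0}\varphi_{\omega_1\cdots\omega_n}(X)$$ be the limit set and, for $\delta\ge0$, let $$P(\delta)=\limsup_{n\to\infty}\frac1n\log\sum_{\omega\in I^n}\Bigl(\sup_{x\in X}|\varphi_\omega'(x)|\Bigr)^{\delta}\in[-\infty,\infty]$$ be the pressure function. Then $$\dim_H J(\Phi)=\inf\{\delta\ge0: P(\delta)<0\}=\sup_{F}\dim_H J(\Phi_F),$$ where $F$ runs over the finite subsets of $I$ and $\Phi_F=\{\varphi_i\}_{i\in F}$. -/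

import Mathlib

open scoped ENNReal NNReal

noncomputable section

/-- The composition `φ_ω = φ_{ω₁} ∘ ⋯ ∘ φ_{ωₙ}` along a finite word `ω`. -/
def wordMap {E I : Type*} (φ : I → E → E) : List I → E → E
  | [] => id
  | i :: ω => φ i ∘ wordMap φ ω

theorem wordMap_subtype {E I : Type*} (φ : I → E → E) (A : Set I) (ω : List A) :
    wordMap (fun i : A => φ i) ω = wordMap φ (ω.map Subtype.val) := by
  induction ω with
  | nil => rfl
  | cons i ω ih => simp [wordMap, ih]

/-- A conformal iterated function system `{φ_i : X → X}` in `ℝ^d` in the sense of Mauldin and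
Urbański, but without the cone condition. The maps are total functions on `ℝ^d`, of which only the
values on `V` matter. Contraction is not part of this structure, see
`ConformalIFS.ContractingBy`. -/
structure ConformalIFS (d : ℕ) (I : Type*) where
  /-- The compact phase space. -/
  X : Set (EuclideanSpace ℝ (Fin d))
  /-- The open connected neighbourhood of `X` to which the maps extend conformally. -/
  V : Set (EuclideanSpace ℝ (Fin d))
  /-- The generators. -/
  φ : I → EuclideanSpace ℝ (Fin d) → EuclideanSpace ℝ (Fin d)
  isCompact_X : IsCompact X
  isOpen_V : IsOpen V
  isConnected_V : IsConnected V
  X_subset_V : X ⊆ V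
  mapsTo_X : ∀ i, Set.MapsTo (φ i) X X
  /-- Each `φ i` is a `C¹` conformal diffeomorphism of `V` onto a subset of `V`. -/
  mapsTo_V : ∀ i, Set.MapsTo (φ i) V V
  injOn_V : ∀ i, Set.InjOn (φ i) V
  contDiffOn_V : ∀ i, ContDiffOn ℝ 1 (φ i) V
  conformalAt_V : ∀ i, ∀ x ∈ V, ConformalAt (φ i) x
  /-- Open set condition, with the interior of `X` in `ℝ^d` as open set. -/
  nonempty_interior : (interior X).Nonempty
  mapsTo_interior : ∀ i, Set.MapsTo (φ i) (interior X) (interior X)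
  disjoint_interior : ∀ i j, i ≠ j → Disjoint (φ i '' interior X) (φ j '' interior X)
  /-- Bounded distortion property. -/
  bounded_distortion : ∃ K : ℝ, 1 ≤ K ∧ ∀ ω : List I, ∀ x ∈ V, ∀ y ∈ V,
    ‖fderiv ℝ (wordMap φ ω) y‖ ≤ K * ‖fderiv ℝ (wordMap φ ω) x‖

namespace ConformalIFS

variable {d : ℕ} {I : Type*}

/-- The derivative bound `|φ_i'(x)| ≤ s` for all `i` and all `x ∈ X`. -/
def ContractingBy (Φ : ConformalIFS d I) (s : ℝ) : Prop :=
  ∀ i, ∀ x ∈ Φ.X, ‖fderiv ℝ (Φ.φ i) x‖ ≤ s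

/-- The limit set `J(Φ) = ⋃_{ω ∈ I^ℕ} ⋂_n φ_{ω|n}(X)`. -/
def limitSet (Φ : ConformalIFS d I) : Set (EuclideanSpace ℝ (Fin d)) :=
  ⋃ ω : ℕ → I, ⋂ n : ℕ, wordMap Φ.φ (List.ofFn fun k : Fin n => ω k) '' Φ.X

/-- `‖φ_ω'‖`, the supremum over `X` of the norm of the derivative of `φ_ω`. -/
def derivNorm (Φ : ConformalIFS d I) (ω : List I) : ℝ≥0∞ :=
  ⨆ x ∈ Φ.X, ‖fderiv ℝ (wordMap Φ.φ ω) x‖ₑ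

/-- The partition function `Z_n(t) = ∑_{|ω| = n} ‖φ_ω'‖ ^ t`. -/
def partitionFunction (Φ : ConformalIFS d I) (n : ℕ) (t : ℝ≥0) : ℝ≥0∞ :=
  ∑' ω : Fin n → I, Φ.derivNorm (List.ofFn ω) ^ (t : ℝ)

/-- The pressure function `P(t) = limsup_n (1/n) log Z_n(t) ∈ [-∞, ∞]`, for `t ≥ 0`. -/
def pressure (Φ : ConformalIFS d I) (t : ℝ≥0) : EReal :=
  Filter.limsup (fun n : ℕ => ENNReal.log (Φ.partitionFunction n t) / (n : EReal)) Filter.atTop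

/-- The subsystem `{φ_i : i ∈ A}`, with the same `X` and `V`. -/
def subsystem (Φ : ConformalIFS d I) (A : Set I) : ConformalIFS d A where
  X := Φ.X
  V := Φ.V
  φ := fun i => Φ.φ i
  isCompact_X := Φ.isCompact_X
  isOpen_V := Φ.isOpen_V
  isConnected_V := Φ.isConnected_V
  X_subset_V := Φ.X_subset_V
  mapsTo_X := fun i => Φ.mapsTo_X i
  mapsTo_V := fun i => Φ.mapsTo_V i
  injOn_V := fun i => Φ.injOn_V i
  contDiffOn_V := fun i => Φ.contDiffOn_V i
  conformalAt_V := fun i => Φ.conformalAt_V i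
  nonempty_interior := Φ.nonempty_interior
  mapsTo_interior := fun i => Φ.mapsTo_interior i
  disjoint_interior := fun i j h => Φ.disjoint_interior i j fun e => h (Subtype.ext e)
  bounded_distortion := by
    obtain ⟨K, hK, h⟩ := Φ.bounded_distortion
    refine ⟨K, hK, fun ω x hx y hy => ?_⟩
    rw [wordMap_subtype]
    exact h _ x hx y hy

end ConformalIFS

end

/-!
Let `K` be a distortion constant. Bounded distortion and the chain rule for conformal maps make
`|φ_ω'|` multiplicative up to the factor `K`, and since `V` is open and connected and `X` is
compact, the diameter of `φ_ω(X)` is at most a constant times `‖φ_ω'‖`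
(`exists_dist_wordMap_le`). Let `h` be the infimum of the exponents with negative pressure.

*Upper bound.* If `P(t) < 0`, the partition functions `Z_n(t)` decay exponentially. The sets
`φ_ω(X)` with `|ω| = n` cover the limit set, so its `t`-dimensional Hausdorff measure is zero
(`dimH_limitSet_le_of_pressure_neg`).

*Lower bound for finite systems.* If `∑ (|φ_i'(z)| / K) ^ t ≥ 1` for a finite system, a Bernoulli
measure with weights at most `(|φ_i'(z)| / K) ^ t` gives the cylinder of `ω` mass at most
`|φ_ω'(z)| ^ t`. To see that its image on the limit set gives sets of diameter `r` mass `O(r ^ t)`,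
cut the sequences at the first word with `|φ_ω'(z)| ≤ r`. As the alphabet is finite, these
derivatives are also bounded below by a multiple of `r`, so conformality gives the disjoint sets
`φ_ω(Int X)` volume comparable to `r ^ d`. This bounds the number of them near a set of diameter `r`
and replaces the cone condition (`HasDistortion.exists_frostman`,
`HasDistortion.le_dimH_limitSet`).

*Approximation.* Let `sup_F dim J(Φ_F) < t < u`. If `Z_n(t)` exceeded `K ^ (2 t)` for some `n ≥ 1`,
then so would already the partition function of a finite subsystem, and the lower bound for the
`n`-th iterate of this subsystem would give its limit set dimension at least `t`. So `Z_n(t)` is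
bounded in `n`, and the contraction ratio `s < 1` turns this into exponential decay of `Z_n(u)`,
that is, `P(u) < 0`. Hence `h ≤ sup_F dim J(Φ_F)`
(`ContractingBy.pressure_neg_of_dimH_subsystem_lt`), while `sup_F dim J(Φ_F) ≤ dim J(Φ) ≤ h`.
-/

open MeasureTheory Set Filter Topology

/-! ### Conformal linear maps -/

theorem IsConformalMap.norm_comp {E F G : Type*} [NormedAddCommGroup E] [NormedSpace ℝ E]
    [NormedAddCommGroup F] [NormedSpace ℝ F] [Nontrivial F] [NormedAddCommGroup G]
    [NormedSpace ℝ G] {f : F →L[ℝ] G} (hf : IsConformalMap f) (g : E →L[ℝ] F) :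
    ‖f ∘L g‖ = ‖f‖ * ‖g‖ := by
  obtain ⟨c, -, li, rfl⟩ := hf
  rw [ContinuousLinearMap.smul_comp, norm_smul, norm_smul, li.norm_toContinuousLinearMap,
    li.norm_toContinuousLinearMap_comp, mul_one]

/-- The determinant of a conformal endomorphism is, up to sign, the power of its norm to the
dimension. -/
theorem IsConformalMap.abs_det {E : Type*} [NormedAddCommGroup E] [InnerProductSpace ℝ E]
    [FiniteDimensional ℝ E] [Nontrivial E] {f : E →L[ℝ] E} (hf : IsConformalMap f) :
    |f.det| = ‖f‖ ^ Module.finrank ℝ E := by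
  obtain ⟨c, -, li, rfl⟩ := hf
  have h1 : |LinearMap.det li.toLinearMap| = 1 := by
    rw [← LinearMap.normDet_eq_abs_det, LinearIsometry.normDet_eq_one]
  have h2 : (c • li.toContinuousLinearMap).det
      = c ^ Module.finrank ℝ E * LinearMap.det li.toLinearMap := by
    rw [← LinearMap.det_smul]
    rfl
  rw [h2, abs_mul, h1, norm_smul, li.norm_toContinuousLinearMap, abs_pow, mul_one, mul_one,
    Real.norm_eq_abs]

/-! ### Derivatives along words -/

theorem wordMap_append {E I : Type*} (φ : I → E → E) (σ τ : List I) :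
    wordMap φ (σ ++ τ) = wordMap φ σ ∘ wordMap φ τ := by
  induction σ with
  | nil => rfl
  | cons i σ ih => simp [wordMap, ih, Function.comp_assoc]

namespace ConformalIFS

variable {d : ℕ} {I : Type*} (Φ : ConformalIFS d I)

/-- The scaling factor `|φ_ω'(x)|`. -/
noncomputable def derivAt (ω : List I) (x : EuclideanSpace ℝ (Fin d)) : ℝ :=
  ‖fderiv ℝ (wordMap Φ.φ ω) x‖

/-- `K` is a bounded distortion constant of the system. -/
def HasDistortion (K : ℝ) : Prop :=
  1 ≤ K ∧ ∀ ω : List I, ∀ x ∈ Φ.V, ∀ y ∈ Φ.V, Φ.derivAt ω y ≤ K * Φ.derivAt ω x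

theorem mapsTo_V_wordMap (ω : List I) : MapsTo (wordMap Φ.φ ω) Φ.V Φ.V := by
  induction ω with
  | nil => exact mapsTo_id _
  | cons i ω ih => exact (Φ.mapsTo_V i).comp ih

theorem mapsTo_X_wordMap (ω : List I) : MapsTo (wordMap Φ.φ ω) Φ.X Φ.X := by
  induction ω with
  | nil => exact mapsTo_id _
  | cons i ω ih => exact (Φ.mapsTo_X i).comp ih

theorem mapsTo_interior_wordMap (ω : List I) :
    MapsTo (wordMap Φ.φ ω) (interior Φ.X) (interior Φ.X) := by
  induction ω with
  | nil => exact mapsTo_id _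
  | cons i ω ih => exact (Φ.mapsTo_interior i).comp ih

theorem injOn_wordMap (ω : List I) : InjOn (wordMap Φ.φ ω) Φ.V := by
  induction ω with
  | nil => exact injOn_id _
  | cons i ω ih => exact (Φ.injOn_V i).comp ih (Φ.mapsTo_V_wordMap ω)

theorem conformalAt_wordMap (ω : List I) {x : EuclideanSpace ℝ (Fin d)} (hx : x ∈ Φ.V) :
    ConformalAt (wordMap Φ.φ ω) x := by
  induction ω with
  | nil => exact conformalAt_id x
  | cons i ω ih => exact (Φ.conformalAt_V i _ (Φ.mapsTo_V_wordMap ω hx)).comp x ih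

theorem differentiableAt_wordMap (ω : List I) {x : EuclideanSpace ℝ (Fin d)} (hx : x ∈ Φ.V) :
    DifferentiableAt ℝ (wordMap Φ.φ ω) x :=
  (Φ.conformalAt_wordMap ω hx).differentiableAt

theorem isConformalMap_fderiv_wordMap (ω : List I) {x : EuclideanSpace ℝ (Fin d)}
    (hx : x ∈ Φ.V) : IsConformalMap (fderiv ℝ (wordMap Φ.φ ω) x) :=
  conformalAt_iff_isConformalMap_fderiv.1 (Φ.conformalAt_wordMap ω hx)

theorem interior_subset_V : interior Φ.X ⊆ Φ.V := interior_subset.trans Φ.X_subset_V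

theorem continuousOn_wordMap (ω : List I) : ContinuousOn (wordMap Φ.φ ω) Φ.V :=
  fun _ hx => (Φ.differentiableAt_wordMap ω hx).continuousAt.continuousWithinAt

theorem isCompact_image_wordMap (ω : List I) : IsCompact (wordMap Φ.φ ω '' Φ.X) :=
  Φ.isCompact_X.image_of_continuousOn ((Φ.continuousOn_wordMap ω).mono Φ.X_subset_V)

theorem image_append_subset (σ τ : List I) :
    wordMap Φ.φ (σ ++ τ) '' Φ.X ⊆ wordMap Φ.φ σ '' Φ.X := by
  rw [wordMap_append, image_comp]
  exact image_mono (Φ.mapsTo_X_wordMap τ).image_subset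

theorem derivAt_nonneg (ω : List I) (x : EuclideanSpace ℝ (Fin d)) : 0 ≤ Φ.derivAt ω x :=
  norm_nonneg _

theorem exists_hasDistortion : ∃ K, Φ.HasDistortion K := Φ.bounded_distortion

theorem derivAt_append [NeZero d] (σ τ : List I) {x : EuclideanSpace ℝ (Fin d)} (hx : x ∈ Φ.V) :
    Φ.derivAt (σ ++ τ) x = Φ.derivAt σ (wordMap Φ.φ τ x) * Φ.derivAt τ x := by
  have hy := Φ.mapsTo_V_wordMap τ hx
  rw [derivAt, wordMap_append, fderiv_comp x (Φ.differentiableAt_wordMap σ hy)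
    (Φ.differentiableAt_wordMap τ hx), (Φ.isConformalMap_fderiv_wordMap σ hy).norm_comp]
  rfl

theorem derivAt_nil [NeZero d] (x : EuclideanSpace ℝ (Fin d)) : Φ.derivAt [] x = 1 := by
  simp [derivAt, wordMap]

theorem derivAt_pos [NeZero d] (ω : List I) {x : EuclideanSpace ℝ (Fin d)} (hx : x ∈ Φ.V) :
    0 < Φ.derivAt ω x :=
  norm_pos_iff.2 (Φ.isConformalMap_fderiv_wordMap ω hx).ne_zero

theorem ContractingBy.derivAt_le [NeZero d] {s : ℝ} (hs : 0 ≤ s) {Φ : ConformalIFS d I}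
    (hΦ : Φ.ContractingBy s) (ω : List I) {x : EuclideanSpace ℝ (Fin d)} (hx : x ∈ Φ.X) :
    Φ.derivAt ω x ≤ s ^ ω.length := by
  induction ω with
  | nil => simp [derivAt_nil]
  | cons i ω ih =>
    rw [← List.singleton_append, derivAt_append _ _ _ (Φ.X_subset_V hx), List.length_append,
      pow_add]
    exact mul_le_mul (by simpa [derivAt, wordMap] using hΦ i _ (Φ.mapsTo_X_wordMap ω hx)) ih
      (Φ.derivAt_nonneg _ _) (by positivity)

theorem HasDistortion.le_derivAt_append [NeZero d] {K : ℝ} {Φ : ConformalIFS d I}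
    (hK : Φ.HasDistortion K) (σ τ : List I) {x : EuclideanSpace ℝ (Fin d)} (hx : x ∈ Φ.V) :
    Φ.derivAt σ x / K * Φ.derivAt τ x ≤ Φ.derivAt (σ ++ τ) x := by
  have hK0 : 0 < K := zero_lt_one.trans_le hK.1
  rw [derivAt_append _ _ _ hx]
  refine mul_le_mul_of_nonneg_right ?_ (Φ.derivAt_nonneg _ _)
  rw [div_le_iff₀' hK0]
  exact hK.2 σ _ (Φ.mapsTo_V_wordMap τ hx) _ hx

theorem ofReal_derivAt_le_derivNorm (ω : List I) {x : EuclideanSpace ℝ (Fin d)} (hx : x ∈ Φ.X) :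
    ENNReal.ofReal (Φ.derivAt ω x) ≤ Φ.derivNorm ω := by
  rw [derivAt, ofReal_norm]
  exact le_iSup₂ (f := fun x _ => ‖fderiv ℝ (wordMap Φ.φ ω) x‖ₑ) x hx

theorem derivNorm_le {ω : List I} {c : ℝ} (h : ∀ x ∈ Φ.X, Φ.derivAt ω x ≤ c) :
    Φ.derivNorm ω ≤ ENNReal.ofReal c := by
  refine iSup₂_le fun x hx => ?_
  rw [← ofReal_norm]
  exact ENNReal.ofReal_le_ofReal (h x hx)

theorem HasDistortion.derivNorm_le {K : ℝ} {Φ : ConformalIFS d I} (hK : Φ.HasDistortion K)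
    (ω : List I) {x : EuclideanSpace ℝ (Fin d)} (hx : x ∈ Φ.V) :
    Φ.derivNorm ω ≤ ENNReal.ofReal (K * Φ.derivAt ω x) :=
  Φ.derivNorm_le fun y hy => hK.2 ω x hx y (Φ.X_subset_V hy)

theorem ContractingBy.derivNorm_le [NeZero d] {s : ℝ} (hs : 0 ≤ s) {Φ : ConformalIFS d I}
    (hΦ : Φ.ContractingBy s) (ω : List I) : Φ.derivNorm ω ≤ ENNReal.ofReal s ^ ω.length := by
  rw [← ENNReal.ofReal_pow hs]
  exact ConformalIFS.derivNorm_le _ fun x hx => hΦ.derivAt_le hs ω hx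

/-! ### Size and position of the cylinder sets -/

/-- Any two points of a compact subset of a connected open set `V` are joined by a chain of balls
in `V` of bounded total length, so that maps with derivative bounded by `M` on `V` expand their
distance at most to a multiple of `M`. Such a chain replaces segments, which need not lie in
`V`. -/
theorem exists_dist_le_of_fderiv_le {E F : Type*} [NormedAddCommGroup E] [NormedSpace ℝ E]
    [NormedAddCommGroup F] [NormedSpace ℝ F] {V X : Set E} (hV : IsOpen V)
    (hc : IsPreconnected V) (hX : IsCompact X) (hXV : X ⊆ V) :
    ∃ L : ℝ, 0 ≤ L ∧ ∀ (g : E → F) (M : ℝ), 0 ≤ M → (∀ x ∈ V, DifferentiableAt ℝ g x) →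
      (∀ x ∈ V, ‖fderiv ℝ g x‖ ≤ M) → ∀ x ∈ X, ∀ y ∈ X, dist (g x) (g y) ≤ L * M := by
  have hball : ∀ x ∈ V, ∃ r > 0, Metric.ball x r ⊆ V ∧ ∀ (g : E → F) (M : ℝ), 0 ≤ M →
      (∀ x ∈ V, DifferentiableAt ℝ g x) → (∀ x ∈ V, ‖fderiv ℝ g x‖ ≤ M) →
      ∀ y ∈ Metric.ball x r, dist (g x) (g y) ≤ r * M := by
    intro x hx
    obtain ⟨r, hr, hrV⟩ := Metric.isOpen_iff.1 hV x hx
    refine ⟨r, hr, hrV, fun g M hM hd hb y hy => ?_⟩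
    rw [dist_comm, dist_eq_norm]
    calc ‖g y - g x‖ ≤ M * ‖y - x‖ :=
          (convex_ball x r).norm_image_sub_le_of_norm_fderiv_le (fun z hz => hd z (hrV hz))
            (fun z hz => hb z (hrV hz)) (Metric.mem_ball_self hr) hy
      _ ≤ M * r := by
          gcongr
          exact (mem_ball_iff_norm.1 hy).le
      _ = r * M := mul_comm _ _
  rcases X.eq_empty_or_nonempty with rfl | ⟨x₀, hx₀⟩
  · exact ⟨0, le_rfl, fun g M _ _ _ x hx => hx.elim⟩
  have hpair : ∀ x ∈ V, ∀ y ∈ V, ∃ L : ℝ, ∀ (g : E → F) (M : ℝ), 0 ≤ M →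
      (∀ x ∈ V, DifferentiableAt ℝ g x) → (∀ x ∈ V, ‖fderiv ℝ g x‖ ≤ M) →
      dist (g x) (g y) ≤ L * M := by
    intro x hx y hy
    refine hc.induction₂ (fun x y => ∃ L : ℝ, ∀ (g : E → F) (M : ℝ), 0 ≤ M →
      (∀ x ∈ V, DifferentiableAt ℝ g x) → (∀ x ∈ V, ‖fderiv ℝ g x‖ ≤ M) →
      dist (g x) (g y) ≤ L * M) ?_ ?_ ?_ hx hy
    · intro x hx
      obtain ⟨r, hr, -, h⟩ := hball x hx
      filter_upwards [mem_nhdsWithin_of_mem_nhds (Metric.ball_mem_nhds x hr)] with y hy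
      exact ⟨r, fun g M hM hd hb => h g M hM hd hb y hy⟩
    · rintro x y z - - - ⟨L₁, h₁⟩ ⟨L₂, h₂⟩
      refine ⟨L₁ + L₂, fun g M hM hd hb => (dist_triangle _ (g y) _).trans ?_⟩
      rw [add_mul]
      exact add_le_add (h₁ g M hM hd hb) (h₂ g M hM hd hb)
    · rintro x y - - ⟨L, h⟩
      exact ⟨L, fun g M hM hd hb => dist_comm (g x) (g y) ▸ h g M hM hd hb⟩
  have hunif : ∃ L : ℝ, 0 ≤ L ∧ ∀ (g : E → F) (M : ℝ), 0 ≤ M →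
      (∀ x ∈ V, DifferentiableAt ℝ g x) → (∀ x ∈ V, ‖fderiv ℝ g x‖ ≤ M) →
      ∀ y ∈ X, dist (g x₀) (g y) ≤ L * M := by
    refine hX.induction_on (p := fun A => ∃ L : ℝ, 0 ≤ L ∧ ∀ (g : E → F) (M : ℝ), 0 ≤ M →
      (∀ x ∈ V, DifferentiableAt ℝ g x) → (∀ x ∈ V, ‖fderiv ℝ g x‖ ≤ M) →
      ∀ y ∈ A, dist (g x₀) (g y) ≤ L * M) ?_ ?_ ?_ ?_
    · exact ⟨0, le_rfl, fun g M _ _ _ y hy => hy.elim⟩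
    · rintro A B hAB ⟨L, hL, h⟩
      exact ⟨L, hL, fun g M hM hd hb y hy => h g M hM hd hb y (hAB hy)⟩
    · rintro A B ⟨L₁, hL₁, h₁⟩ ⟨L₂, hL₂, h₂⟩
      refine ⟨L₁ + L₂, add_nonneg hL₁ hL₂, fun g M hM hd hb y hy => ?_⟩
      rw [add_mul]
      rcases hy with hy | hy
      · exact (h₁ g M hM hd hb y hy).trans (le_add_of_nonneg_right (mul_nonneg hL₂ hM))
      · exact (h₂ g M hM hd hb y hy).trans (le_add_of_nonneg_left (mul_nonneg hL₁ hM))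
    · intro x hx
      obtain ⟨r, hr, -, h⟩ := hball x (hXV hx)
      obtain ⟨L, hL⟩ := hpair x₀ (hXV hx₀) x (hXV hx)
      refine ⟨Metric.ball x r, mem_nhdsWithin_of_mem_nhds (Metric.ball_mem_nhds x hr),
        |L| + r, by positivity, fun g M hM hd hb y hy => (dist_triangle _ (g x) _).trans ?_⟩
      rw [add_mul]
      refine add_le_add ((hL g M hM hd hb).trans ?_) (h g M hM hd hb y hy)
      exact mul_le_mul_of_nonneg_right (le_abs_self L) hM
  obtain ⟨L, hL, h⟩ := hunif
  refine ⟨2 * L, by positivity, fun g M hM hd hb x hx y hy => ?_⟩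
  have h1 := dist_triangle_left (g x) (g y) (g x₀)
  have h2 := h g M hM hd hb x hx
  have h3 := h g M hM hd hb y hy
  linarith

theorem exists_dist_wordMap_le : ∃ C : ℝ, 0 ≤ C ∧ ∀ (ω : List I), ∀ z ∈ Φ.V,
    ∀ x ∈ Φ.X, ∀ y ∈ Φ.X, dist (wordMap Φ.φ ω x) (wordMap Φ.φ ω y) ≤ C * Φ.derivAt ω z := by
  obtain ⟨K, hK⟩ := Φ.exists_hasDistortion
  have hK0 : 0 ≤ K := zero_le_one.trans hK.1
  obtain ⟨L, hL, h⟩ := exists_dist_le_of_fderiv_le (F := EuclideanSpace ℝ (Fin d)) Φ.isOpen_V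
    Φ.isConnected_V.isPreconnected Φ.isCompact_X Φ.X_subset_V
  refine ⟨L * K, by positivity, fun ω z hz x hx y hy => ?_⟩
  rw [mul_assoc]
  exact h _ _ (mul_nonneg hK0 (Φ.derivAt_nonneg _ _))
    (fun v hv => Φ.differentiableAt_wordMap ω hv) (fun v hv => hK.2 ω z hz v hv) x hx y hy

/-- Images of the interior under incomparable words are disjoint, by the open set condition for
the first letters in which the words differ. -/
theorem disjoint_image_interior {σ τ : List I} (h₁ : ¬ σ <+: τ) (h₂ : ¬ τ <+: σ) :
    Disjoint (wordMap Φ.φ σ '' interior Φ.X) (wordMap Φ.φ τ '' interior Φ.X) := by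
  induction σ generalizing τ with
  | nil => exact absurd List.nil_prefix h₁
  | cons i σ ih =>
    cases τ with
    | nil => exact absurd List.nil_prefix h₂
    | cons j τ =>
      simp only [wordMap, image_comp]
      by_cases hij : i = j
      · subst hij
        rw [List.cons_prefix_cons] at h₁ h₂
        rw [disjoint_iff_inter_eq_empty,
          ← (Φ.injOn_V i).image_inter
            ((Φ.mapsTo_interior_wordMap σ).image_subset.trans Φ.interior_subset_V)
            ((Φ.mapsTo_interior_wordMap τ).image_subset.trans Φ.interior_subset_V),
          (ih (fun h => h₁ ⟨rfl, h⟩) (fun h => h₂ ⟨rfl, h⟩)).inter_eq, image_empty]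
      · exact (Φ.disjoint_interior i j hij).mono
          (image_mono (Φ.mapsTo_interior_wordMap σ).image_subset)
          (image_mono (Φ.mapsTo_interior_wordMap τ).image_subset)

/-- The volume of the image of the interior is comparable to the `d`-th power of the derivative,
because `φ_ω` is conformal with bounded distortion. -/
theorem HasDistortion.le_volume_image [NeZero d] {K : ℝ} {Φ : ConformalIFS d I}
    (hK : Φ.HasDistortion K) (ω : List I) {z : EuclideanSpace ℝ (Fin d)} (hz : z ∈ Φ.V) :
    ENNReal.ofReal (Φ.derivAt ω z / K) ^ d * volume (interior Φ.X) ≤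
      volume (wordMap Φ.φ ω '' interior Φ.X) := by
  have hK0 : 0 < K := zero_lt_one.trans_le hK.1
  rw [← lintegral_abs_det_fderiv_eq_addHaar_image volume isOpen_interior.measurableSet
    (fun x hx => (Φ.differentiableAt_wordMap ω
      (Φ.interior_subset_V hx)).hasFDerivAt.hasFDerivWithinAt)
    ((Φ.injOn_wordMap ω).mono Φ.interior_subset_V), ← setLIntegral_const]
  refine setLIntegral_mono' isOpen_interior.measurableSet fun x hx => ?_
  have hxV := Φ.interior_subset_V hx
  rw [(Φ.isConformalMap_fderiv_wordMap ω hxV).abs_det, finrank_euclideanSpace_fin,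
    ENNReal.ofReal_pow (norm_nonneg _)]
  gcongr
  rw [div_le_iff₀' hK0]
  exact hK.2 ω x hxV z hz

theorem measurableSet_image_interior (ω : List I) :
    MeasurableSet (wordMap Φ.φ ω '' interior Φ.X) :=
  isOpen_interior.measurableSet.image_of_continuousOn_injOn
    ((Φ.continuousOn_wordMap ω).mono Φ.interior_subset_V)
    ((Φ.injOn_wordMap ω).mono Φ.interior_subset_V)

/-! ### Pressure and exponential growth of the partition functions -/

theorem exists_partitionFunction_le_pow_of_pressure_neg {t : ℝ≥0} (h : Φ.pressure t < 0) :
    ∃ q < 1, ∀ᶠ n in atTop, Φ.partitionFunction n t ≤ q ^ n := by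
  obtain ⟨c, hc, hc0⟩ := exists_between h
  refine ⟨EReal.exp c, ?_, ?_⟩
  · rwa [← ENNReal.log_lt_zero_iff, EReal.log_exp]
  · filter_upwards [eventually_lt_of_limsup_lt hc, eventually_ge_atTop 1] with n hn hn1
    have h0 : (0 : EReal) < (n : EReal) := by exact_mod_cast hn1
    rw [← ENNReal.log_le_log_iff, ENNReal.log_pow, EReal.log_exp]
    exact (EReal.div_le_iff_le_mul h0 (EReal.natCast_ne_top n)).1 hn.le

theorem pressure_neg_of_partitionFunction_le {t : ℝ≥0} {M q : ℝ≥0∞} (hM : M ≠ ∞) (hq : q < 1)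
    (h : ∀ᶠ n in atTop, Φ.partitionFunction n t ≤ M * q ^ n) : Φ.pressure t < 0 := by
  -- The room between `q` and `q'` absorbs the constant `M`.
  obtain ⟨q', hqq', hq'⟩ := exists_between hq
  have hq'0 : q' ≠ 0 := (pos_of_gt hqq').ne'
  have hq't : q' ≠ ∞ := (hq'.trans ENNReal.one_lt_top).ne
  have hlim : Tendsto (fun n : ℕ => M * (q / q') ^ n) atTop (𝓝 0) := by
    rw [← mul_zero M]
    refine ENNReal.Tendsto.const_mul (ENNReal.tendsto_pow_atTop_nhds_zero_of_lt_one ?_)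
      (Or.inr hM)
    rwa [ENNReal.div_lt_iff (Or.inl hq'0) (Or.inl hq't), one_mul]
  refine lt_of_le_of_lt (limsup_le_of_le (a := ENNReal.log q') (by isBoundedDefault) ?_)
    (ENNReal.log_lt_zero_iff.2 hq')
  filter_upwards [h, hlim.eventually_le_const zero_lt_one, eventually_ge_atTop 1] with n hn h1 hn1
  have h0 : (0 : EReal) < (n : EReal) := by exact_mod_cast hn1
  rw [EReal.div_le_iff_le_mul h0 (EReal.natCast_ne_top n), ← ENNReal.log_pow,
    ENNReal.log_le_log_iff]
  refine hn.trans ?_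
  calc M * q ^ n = M * (q / q') ^ n * q' ^ n := by
        rw [mul_assoc, ← mul_pow, ENNReal.div_mul_cancel hq'0 hq't]
    _ ≤ 1 * q' ^ n := by gcongr
    _ = q' ^ n := one_mul _

/-! ### The upper bound for the dimension -/

theorem nonempty_X : Φ.X.Nonempty := Φ.nonempty_interior.mono interior_subset

theorem limitSet_subset_iUnion (n : ℕ) :
    Φ.limitSet ⊆ ⋃ ω : Fin n → I, wordMap Φ.φ (List.ofFn ω) '' Φ.X := by
  intro x hx
  obtain ⟨ω, hω⟩ := mem_iUnion.1 hx
  exact mem_iUnion.2 ⟨fun k => ω k, mem_iInter.1 hω n⟩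

theorem exists_ediam_image_le : ∃ C : ℝ, 0 ≤ C ∧ ∀ ω : List I,
    Metric.ediam (wordMap Φ.φ ω '' Φ.X) ≤ ENNReal.ofReal C * Φ.derivNorm ω := by
  obtain ⟨C, hC, h⟩ := Φ.exists_dist_wordMap_le
  obtain ⟨z, hz⟩ := Φ.nonempty_X
  refine ⟨C, hC, fun ω => Metric.ediam_le ?_⟩
  rintro _ ⟨x, hx, rfl⟩ _ ⟨y, hy, rfl⟩
  rw [edist_dist]
  refine (ENNReal.ofReal_le_ofReal (h ω z (Φ.X_subset_V hz) x hx y hy)).trans ?_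
  rw [ENNReal.ofReal_mul hC]
  gcongr
  exact Φ.ofReal_derivAt_le_derivNorm ω hz

/-- The cylinder sets of level `n` cover the limit set, and negative pressure at `t` makes the sum
of the `t`-th powers of their diameters tend to zero. -/
theorem dimH_limitSet_le_of_pressure_neg [NeZero d] [Countable I] {s : ℝ} (hs0 : 0 ≤ s)
    (hs : s < 1) (hΦ : Φ.ContractingBy s) {t : ℝ≥0} (ht : Φ.pressure t < 0) :
    dimH Φ.limitSet ≤ t := by
  obtain ⟨C, hC, hdiam⟩ := Φ.exists_ediam_image_le
  obtain ⟨q, hq, hZ⟩ := Φ.exists_partitionFunction_le_pow_of_pressure_neg ht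
  have hs' : ENNReal.ofReal s < 1 := by rwa [ENNReal.ofReal_lt_one]
  have hr : Tendsto (fun n : ℕ => ENNReal.ofReal C * ENNReal.ofReal s ^ n) atTop (𝓝 0) := by
    rw [← mul_zero (ENNReal.ofReal C)]
    exact ENNReal.Tendsto.const_mul (ENNReal.tendsto_pow_atTop_nhds_zero_of_lt_one hs')
      (Or.inr ENNReal.ofReal_ne_top)
  have hlim : Tendsto (fun n : ℕ => ENNReal.ofReal C ^ (t : ℝ) * q ^ n) atTop (𝓝 0) := by
    rw [← mul_zero (ENNReal.ofReal C ^ (t : ℝ))]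
    exact ENNReal.Tendsto.const_mul (ENNReal.tendsto_pow_atTop_nhds_zero_of_lt_one hq)
      (Or.inr (ENNReal.rpow_ne_top_of_nonneg t.coe_nonneg ENNReal.ofReal_ne_top))
  refine dimH_le_of_hausdorffMeasure_ne_top (ne_top_of_le_ne_top ENNReal.zero_ne_top ?_)
  refine (Measure.hausdorffMeasure_le_liminf_tsum (t : ℝ) Φ.limitSet
    (ι := fun n : ℕ => Fin n → I) _ hr (fun n ω => wordMap Φ.φ (List.ofFn ω) '' Φ.X)
    (Eventually.of_forall fun n ω => ?_)
    (Eventually.of_forall Φ.limitSet_subset_iUnion)).trans ?_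
  · refine (hdiam _).trans ?_
    gcongr
    simpa using hΦ.derivNorm_le hs0 (List.ofFn ω)
  · rw [← hlim.liminf_eq]
    refine liminf_le_liminf ?_
    filter_upwards [hZ] with n hn
    calc ∑' ω : Fin n → I, Metric.ediam (wordMap Φ.φ (List.ofFn ω) '' Φ.X) ^ (t : ℝ)
        ≤ ∑' ω : Fin n → I, ENNReal.ofReal C ^ (t : ℝ) * Φ.derivNorm (List.ofFn ω) ^ (t : ℝ) := by
          refine ENNReal.tsum_le_tsum fun ω => ?_
          rw [← ENNReal.mul_rpow_of_nonneg _ _ t.coe_nonneg]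
          exact ENNReal.rpow_le_rpow (hdiam _) t.coe_nonneg
      _ = ENNReal.ofReal C ^ (t : ℝ) * Φ.partitionFunction n t := ENNReal.tsum_mul_left
      _ ≤ _ := by gcongr

/-! ### Subsystems and iterates -/

/-- The word formed by the first `n` letters of an infinite word. -/
def initialWord (ω : ℕ → I) (n : ℕ) : List I := List.ofFn fun k : Fin n => ω k

theorem initialWord_succ (ω : ℕ → I) (n : ℕ) :
    initialWord ω (n + 1) = initialWord ω n ++ [ω n] := by
  rw [initialWord, List.ofFn_succ', List.concat_eq_append]
  rfl

theorem length_initialWord (ω : ℕ → I) (n : ℕ) : (initialWord ω n).length = n := by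
  simp [initialWord]

theorem initialWord_prefix (ω : ℕ → I) {m n : ℕ} (h : m ≤ n) :
    initialWord ω m <+: initialWord ω n := by
  induction n, h using Nat.le_induction with
  | base => exact List.prefix_refl _
  | succ n _ ih =>
    rw [initialWord_succ]
    exact ih.trans (List.prefix_append _ _)

theorem antitone_image_initialWord (ω : ℕ → I) :
    Antitone fun n => wordMap Φ.φ (initialWord ω n) '' Φ.X := by
  intro m n h
  obtain ⟨τ, hτ⟩ := initialWord_prefix ω h
  change wordMap Φ.φ (initialWord ω n) '' Φ.X ⊆ wordMap Φ.φ (initialWord ω m) '' Φ.X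
  rw [← hτ]
  exact Φ.image_append_subset _ _

theorem wordMap_subsystem (A : Set I) (ω : List A) :
    wordMap (Φ.subsystem A).φ ω = wordMap Φ.φ (ω.map Subtype.val) :=
  wordMap_subtype Φ.φ A ω

theorem derivNorm_subsystem (A : Set I) (ω : List A) :
    (Φ.subsystem A).derivNorm ω = Φ.derivNorm (ω.map Subtype.val) := by
  simp only [derivNorm, wordMap_subsystem]
  rfl

theorem limitSet_subsystem_subset (A : Set I) : (Φ.subsystem A).limitSet ⊆ Φ.limitSet := by
  intro x hx
  obtain ⟨ω, hω⟩ := mem_iUnion.1 hx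
  refine mem_iUnion.2 ⟨fun n => ω n, mem_iInter.2 fun n => ?_⟩
  have := mem_iInter.1 hω n
  rw [wordMap_subsystem, List.map_ofFn] at this
  exact this

theorem ContractingBy.subsystem {s : ℝ} {Φ : ConformalIFS d I} (h : Φ.ContractingBy s)
    (A : Set I) : (Φ.subsystem A).ContractingBy s := fun i => h i

theorem HasDistortion.subsystem {K : ℝ} {Φ : ConformalIFS d I} (h : Φ.HasDistortion K)
    (A : Set I) : (Φ.subsystem A).HasDistortion K := by
  refine ⟨h.1, fun ω x hx y hy => ?_⟩
  rw [derivAt, derivAt, wordMap_subsystem]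
  exact h.2 _ x hx y hy

theorem exists_lt_partitionFunction_subsystem {n : ℕ} {t : ℝ≥0} {M : ℝ≥0∞}
    (h : M < Φ.partitionFunction n t) :
    ∃ F : Finset I, M < (Φ.subsystem (F : Set I)).partitionFunction n t := by
  classical
  rw [partitionFunction, ENNReal.tsum_eq_iSup_sum, lt_iSup_iff] at h
  obtain ⟨W, hW⟩ := h
  refine ⟨W.biUnion fun ω => Finset.univ.image ω, hW.trans_le ?_⟩
  have hmem (ω : W) (k : Fin n) :
      ω.1 k ∈ ((W.biUnion fun ω => Finset.univ.image ω : Finset I) : Set I) := by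
    simp only [Finset.coe_biUnion, mem_iUnion]
    exact ⟨ω.1, ω.2, by simp⟩
  have hinj : Function.Injective fun (ω : W) (k : Fin n) =>
      (⟨ω.1 k, hmem ω k⟩ : ((W.biUnion fun ω => Finset.univ.image ω : Finset I) : Set I)) := by
    intro ω ω' h
    ext k
    exact congrArg Subtype.val (congrFun h k)
  rw [← Finset.tsum_subtype, partitionFunction]
  refine le_trans (le_of_eq ?_) (ENNReal.tsum_comp_le_tsum_of_injective hinj _)
  refine tsum_congr fun ω => ?_
  rw [derivNorm_subsystem, List.map_ofFn]
  rfl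

theorem contDiffOn_wordMap (ω : List I) : ContDiffOn ℝ 1 (wordMap Φ.φ ω) Φ.V := by
  induction ω with
  | nil => exact contDiffOn_id
  | cons i ω ih => exact (Φ.contDiffOn_V i).comp ih (Φ.mapsTo_V_wordMap ω)

theorem wordMap_wordMap {E : Type*} (φ : I → E → E) {n : ℕ} (W : List (Fin n → I)) :
    wordMap (fun ω : Fin n → I => wordMap φ (List.ofFn ω)) W =
      wordMap φ (W.map List.ofFn).flatten := by
  induction W with
  | nil => rfl
  | cons ω W ih => rw [wordMap, ih, List.map_cons, List.flatten_cons, wordMap_append]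

/-- The `n`-th iterate of the system, whose generators are the maps `φ_ω` for words `ω` of
length `n`. -/
def iterate (n : ℕ) : ConformalIFS d (Fin n → I) where
  X := Φ.X
  V := Φ.V
  φ := fun ω => wordMap Φ.φ (List.ofFn ω)
  isCompact_X := Φ.isCompact_X
  isOpen_V := Φ.isOpen_V
  isConnected_V := Φ.isConnected_V
  X_subset_V := Φ.X_subset_V
  mapsTo_X := fun _ => Φ.mapsTo_X_wordMap _
  mapsTo_V := fun _ => Φ.mapsTo_V_wordMap _
  injOn_V := fun _ => Φ.injOn_wordMap _
  contDiffOn_V := fun _ => Φ.contDiffOn_wordMap _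
  conformalAt_V := fun _ _ hx => Φ.conformalAt_wordMap _ hx
  nonempty_interior := Φ.nonempty_interior
  mapsTo_interior := fun _ => Φ.mapsTo_interior_wordMap _
  disjoint_interior := fun ω τ h => by
    refine Φ.disjoint_image_interior (fun hp => h ?_) (fun hp => h ?_)
    · exact List.ofFn_injective (hp.eq_of_length (by simp))
    · exact (List.ofFn_injective (hp.eq_of_length (by simp))).symm
  bounded_distortion := by
    obtain ⟨K, hK, h⟩ := Φ.bounded_distortion
    refine ⟨K, hK, fun W x hx y hy => ?_⟩
    rw [wordMap_wordMap]
    exact h _ x hx y hy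

theorem wordMap_iterate {n : ℕ} (W : List (Fin n → I)) :
    wordMap (Φ.iterate n).φ W = wordMap Φ.φ (W.map List.ofFn).flatten :=
  wordMap_wordMap Φ.φ W

theorem HasDistortion.iterate {K : ℝ} {Φ : ConformalIFS d I} (h : Φ.HasDistortion K) (n : ℕ) :
    (Φ.iterate n).HasDistortion K := by
  refine ⟨h.1, fun W x hx y hy => ?_⟩
  rw [derivAt, derivAt, wordMap_iterate]
  exact h.2 _ x hx y hy

theorem ContractingBy.iterate [NeZero d] {s : ℝ} (hs : 0 ≤ s) {Φ : ConformalIFS d I}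
    (h : Φ.ContractingBy s) (n : ℕ) : (Φ.iterate n).ContractingBy (s ^ n) := by
  intro ω x hx
  have := h.derivAt_le hs (List.ofFn ω) hx
  rwa [List.length_ofFn] at this

theorem limitSet_iterate_subset {n : ℕ} (hn : 0 < n) : (Φ.iterate n).limitSet ⊆ Φ.limitSet := by
  intro x hx
  obtain ⟨w, hw⟩ := mem_iUnion.1 hx
  -- `a` is the concatenation of the blocks `w 0`, `w 1`, ….
  let a : ℕ → I := fun m => w (m / n) ⟨m % n, Nat.mod_lt _ hn⟩
  refine mem_iUnion.2 ⟨a, mem_iInter.2 fun m => ?_⟩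
  refine Φ.antitone_image_initialWord a (Nat.le_mul_of_pos_right m hn) ?_
  have hx := mem_iInter.1 hw m
  rw [wordMap_iterate, List.map_ofFn] at hx
  suffices h : initialWord a (m * n) =
      (List.ofFn (List.ofFn ∘ fun k : Fin m => w k)).flatten by
    change x ∈ wordMap Φ.φ (initialWord a (m * n)) '' Φ.X
    rw [h]
    exact hx
  rw [initialWord, List.ofFn_mul]
  congr 3
  funext i
  refine congrArg List.ofFn (funext fun j => ?_)
  have h1 : (↑i * n + ↑j : ℕ) / n = i := by
    rw [add_comm, Nat.add_mul_div_right _ _ hn, Nat.div_eq_of_lt j.2, zero_add]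
  have h2 : (↑i * n + ↑j : ℕ) % n = j := by
    rw [Nat.mul_add_mod_self_right, Nat.mod_eq_of_lt j.2]
  simp only [a, h1, h2]

/-! ### Bernoulli measures and the coding map -/

/-- Weights with sum at least `1` can be normalized to a Bernoulli measure on sequences that gives
each cylinder at most the product of the weights of its letters. -/
theorem exists_measure_cylinder_le [Fintype I] [MeasurableSpace I] [MeasurableSingletonClass I]
    (a : I → ℝ≥0∞) (ha : 1 ≤ ∑ i, a i) (ha' : ∀ i, a i ≠ ∞) :
    ∃ P : Measure (ℕ → I), IsProbabilityMeasure P ∧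
      ∀ ω n, P {ω' | initialWord ω' n = initialWord ω n} ≤ ∏ k ∈ Finset.range n, a (ω k) := by
  have hS0 : ∑ i, a i ≠ 0 := (zero_lt_one.trans_le ha).ne'
  have hSt : ∑ i, a i ≠ ∞ := ENNReal.sum_ne_top.2 fun i _ => ha' i
  let p : PMF I := PMF.ofFintype (fun i => a i / ∑ j, a j) (by
    simp_rw [div_eq_mul_inv]
    rw [← Finset.sum_mul, ENNReal.mul_inv_cancel hS0 hSt])
  refine ⟨Measure.infinitePi fun _ => p.toMeasure, inferInstance, fun ω n => ?_⟩
  have hset : {ω' : ℕ → I | initialWord ω' n = initialWord ω n} =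
      (Finset.range n : Set ℕ).pi fun k => {ω k} := by
    ext ω'
    simp only [mem_ofPred_eq, Set.mem_pi, Finset.coe_range, mem_Iio, mem_singleton_iff,
      initialWord, List.ofFn_inj, funext_iff]
    exact ⟨fun h k hk => h ⟨k, hk⟩, fun h k => h k k.2⟩
  rw [hset, Measure.infinitePi_pi _ fun k _ => measurableSet_singleton _]
  refine Finset.prod_le_prod' fun k _ => ?_
  rw [p.toMeasure_apply_singleton _ (measurableSet_singleton _), PMF.ofFintype_apply]
  exact ENNReal.div_le_of_le_mul (le_mul_of_one_le_right' ha)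

theorem measurable_initialWord [Countable I] [MeasurableSpace I] [MeasurableSingletonClass I]
    {β : Type*} [MeasurableSpace β] (f : List I → β) (n : ℕ) :
    Measurable fun ω : ℕ → I => f (initialWord ω n) :=
  (measurable_of_countable fun τ : Fin n → I => f (List.ofFn τ)).comp
    (measurable_pi_lambda _ fun k => measurable_pi_apply (k : ℕ))

/-- The coding map, which sends a sequence `ω` to the point of `⋂ n, φ_{ω|n}(X)`, is measurable as
a limit of maps that depend on finitely many letters. -/
theorem exists_measurable_coding [NeZero d] [Countable I] [MeasurableSpace I]
    [MeasurableSingletonClass I] {s : ℝ} (hs0 : 0 ≤ s) (hs : s < 1) (hΦ : Φ.ContractingBy s) :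
    ∃ π : (ℕ → I) → EuclideanSpace ℝ (Fin d), Measurable π ∧
      ∀ ω n, π ω ∈ wordMap Φ.φ (initialWord ω n) '' Φ.X := by
  obtain ⟨C, hC, hdist⟩ := Φ.exists_dist_wordMap_le
  obtain ⟨z, hz⟩ := Φ.nonempty_X
  have hmem (ω : ℕ → I) {m n : ℕ} (h : m ≤ n) :
      wordMap Φ.φ (initialWord ω n) z ∈ wordMap Φ.φ (initialWord ω m) '' Φ.X :=
    Φ.antitone_image_initialWord ω h (mem_image_of_mem _ hz)
  have hlim (ω : ℕ → I) : ∃ x, Tendsto (fun n => wordMap Φ.φ (initialWord ω n) z) atTop (𝓝 x) := by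
    refine cauchySeq_tendsto_of_complete (cauchySeq_of_le_geometric s C hs fun n => ?_)
    obtain ⟨y, hy, hyz⟩ := hmem ω n.le_succ
    rw [← hyz]
    refine (hdist _ z (Φ.X_subset_V hz) z hz y hy).trans ?_
    gcongr
    simpa only [length_initialWord] using hΦ.derivAt_le hs0 (initialWord ω n) hz
  choose π hπ using hlim
  refine ⟨π, measurable_of_tendsto_metrizable
    (fun n => measurable_initialWord (fun τ => wordMap Φ.φ τ z) n) (tendsto_pi_nhds.2 hπ),
    fun ω n => ?_⟩
  refine (Φ.isCompact_image_wordMap _).isClosed.mem_of_tendsto (hπ ω) ?_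
  filter_upwards [eventually_ge_atTop n] with m hm using hmem ω hm

/-! ### Words at a given scale -/

/-- The words `τ` at which `|φ_τ'(z)|` drops to at most `r` for the first time. They form an
antichain, and every infinite word starts with one of them. -/
def cutSet (z : EuclideanSpace ℝ (Fin d)) (r : ℝ) : Set (List I) :=
  {τ | Φ.derivAt τ z ≤ r ∧ ∀ σ, σ <+: τ → σ ≠ τ → r < Φ.derivAt σ z}

theorem not_prefix_of_mem_cutSet {z : EuclideanSpace ℝ (Fin d)} {r : ℝ} {σ τ : List I}
    (hσ : σ ∈ Φ.cutSet z r) (hτ : τ ∈ Φ.cutSet z r) (hne : σ ≠ τ) : ¬ σ <+: τ :=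
  fun h => (hτ.2 σ h hne).not_ge hσ.1

theorem exists_initialWord_mem_cutSet [NeZero d] {s : ℝ} (hs0 : 0 ≤ s) (hs : s < 1)
    (hΦ : Φ.ContractingBy s) {z : EuclideanSpace ℝ (Fin d)} (hz : z ∈ Φ.X) {r : ℝ} (hr : 0 < r)
    (ω : ℕ → I) : ∃ n, initialWord ω n ∈ Φ.cutSet z r := by
  classical
  have hex : ∃ n, Φ.derivAt (initialWord ω n) z ≤ r := by
    obtain ⟨n, hn⟩ := exists_pow_lt_of_lt_one hr hs
    refine ⟨n, le_trans ?_ hn.le⟩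
    simpa only [length_initialWord] using hΦ.derivAt_le hs0 (initialWord ω n) hz
  refine ⟨Nat.find hex, Nat.find_spec hex, fun σ hσ hne => ?_⟩
  have hle : σ.length ≤ Nat.find hex := by simpa only [length_initialWord] using hσ.length_le
  have hσ' : σ = initialWord ω σ.length :=
    (List.prefix_of_prefix_length_le hσ (initialWord_prefix ω hle)
      (length_initialWord ω _).ge).eq_of_length (length_initialWord ω _).symm
  have hlt : σ.length < Nat.find hex := by
    refine hle.lt_of_ne fun h => hne ?_
    rw [hσ', h]
  rw [hσ']
  exact not_le.1 (Nat.find_min hex hlt)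

theorem HasDistortion.le_derivAt_of_mem_cutSet [NeZero d] {K : ℝ} {Φ : ConformalIFS d I}
    (hK : Φ.HasDistortion K) {z : EuclideanSpace ℝ (Fin d)} (hz : z ∈ Φ.V) {m r : ℝ}
    (hr1 : r < 1) (hm0 : 0 < m) (hm : ∀ i, m ≤ Φ.derivAt [i] z) {τ : List I}
    (hτ : τ ∈ Φ.cutSet z r) : r * (m / K) ≤ Φ.derivAt τ z := by
  have hK0 : 0 < K := zero_lt_one.trans_le hK.1
  rcases List.eq_nil_or_concat τ with rfl | ⟨σ, i, rfl⟩
  · have := hτ.1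
    rw [derivAt_nil] at this
    exact absurd this hr1.not_ge
  · rw [List.concat_eq_append] at hτ ⊢
    refine le_trans ?_ (hK.le_derivAt_append σ [i] hz)
    have h1 := hτ.2 σ (List.prefix_append _ _) (by simp)
    calc r * (m / K) = r / K * m := by ring
      _ ≤ Φ.derivAt σ z / K * Φ.derivAt [i] z := by
        gcongr
        · exact div_nonneg (Φ.derivAt_nonneg _ _) hK0.le
        · exact hm i

/-- The mass of a cylinder of a Bernoulli measure with weights at most `(|φ_i'(z)| / K) ^ t` is at
most `|φ_τ'(z)| ^ t`: the factors `K⁻¹` absorb the distortion in the chain rule. -/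
theorem HasDistortion.prod_le_derivAt_initialWord [NeZero d] {K : ℝ} {Φ : ConformalIFS d I}
    (hK : Φ.HasDistortion K) {z : EuclideanSpace ℝ (Fin d)} (hz : z ∈ Φ.V) {t : ℝ} (ht : 0 ≤ t)
    (ω : ℕ → I) (n : ℕ) :
    ∏ k ∈ Finset.range n, ENNReal.ofReal (Φ.derivAt [ω k] z / K) ^ t ≤
      ENNReal.ofReal (Φ.derivAt (initialWord ω n) z) ^ t := by
  have hK0 : 0 < K := zero_lt_one.trans_le hK.1
  induction n with
  | zero => simp [initialWord, derivAt_nil]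
  | succ n ih =>
    rw [Finset.prod_range_succ, initialWord_succ]
    refine (mul_le_mul_left ih _).trans ?_
    rw [← ENNReal.mul_rpow_of_nonneg _ _ ht, ← ENNReal.ofReal_mul (Φ.derivAt_nonneg _ _)]
    refine ENNReal.rpow_le_rpow (ENNReal.ofReal_le_ofReal ?_) ht
    refine le_trans (le_of_eq ?_) (hK.le_derivAt_append (initialWord ω n) [ω n] hz)
    ring

/-! ### The lower bound for the dimension of a finite system -/

/-- A measure on sequences that gives a cylinder mass at most `|φ_τ'(z)| ^ t` satisfies a Frostman
estimate with exponent `t`. The sets `φ_τ(X)`, `τ ∈ cutSet z r`, that meet a set of diameter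
at most `r` contain disjoint sets `φ_τ(Int X)` of volume comparable to `r ^ d` inside a ball of
radius comparable to `r`, so that their number is bounded. -/
theorem HasDistortion.exists_frostman [NeZero d] [Finite I] [Nonempty I] [MeasurableSpace I]
    {K s : ℝ} {Φ : ConformalIFS d I} (hK : Φ.HasDistortion K) (hs0 : 0 ≤ s) (hs : s < 1)
    (hΦ : Φ.ContractingBy s) {z : EuclideanSpace ℝ (Fin d)} (hz : z ∈ Φ.X) {t : ℝ} (ht : 0 ≤ t)
    {P : Measure (ℕ → I)} (hP : ∀ ω n, P {ω' | initialWord ω' n = initialWord ω n} ≤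
      ENNReal.ofReal (Φ.derivAt (initialWord ω n) z) ^ t)
    {π : (ℕ → I) → EuclideanSpace ℝ (Fin d)}
    (hπ : ∀ ω n, π ω ∈ wordMap Φ.φ (initialWord ω n) '' Φ.X) :
    ∃ c : ℝ≥0∞, c ≠ 0 ∧ ∀ r : ℝ, 0 < r → r < 1 → ∀ A : Set (EuclideanSpace ℝ (Fin d)),
      Metric.ediam A ≤ ENNReal.ofReal r → c * P (π ⁻¹' A) ≤ ENNReal.ofReal r ^ t := by
  have hK0 : 0 < K := zero_lt_one.trans_le hK.1
  have hzV := Φ.X_subset_V hz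
  obtain ⟨C, hC, hdist⟩ := Φ.exists_dist_wordMap_le
  obtain ⟨i₀, hi₀⟩ := Finite.exists_min fun i => Φ.derivAt [i] z
  set m := Φ.derivAt [i₀] z with hm
  have hm0 : 0 < m := Φ.derivAt_pos _ hzV
  set v₀ := volume (interior Φ.X)
  set v₁ := volume (Metric.ball (0 : EuclideanSpace ℝ (Fin d)) 1)
  have hv₀ : v₀ ≠ 0 := (isOpen_interior.measure_pos volume Φ.nonempty_interior).ne'
  have hv₁ : v₁ ≠ ∞ := measure_ball_lt_top.ne
  have hv₁' : v₁ ≠ 0 := (Metric.measure_ball_pos volume 0 zero_lt_one).ne'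
  -- Up to the factor `r ^ d`, `c₀` bounds the volume of one set `φ_τ(Int X)` from below and `c₁` is
  -- the volume of a ball that contains all of them.
  set c₀ := ENNReal.ofReal (m / K / K) ^ d * v₀
  set c₁ := ENNReal.ofReal (1 + C) ^ d * v₁
  have hc₀ : c₀ ≠ 0 := mul_ne_zero
    (pow_ne_zero _ (ENNReal.ofReal_pos.2 (by positivity)).ne') hv₀
  have hc₁ : c₁ ≠ ∞ := ENNReal.mul_ne_top (ENNReal.pow_ne_top ENNReal.ofReal_ne_top) hv₁
  have hc₁' : c₁ ≠ 0 := mul_ne_zero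
    (pow_ne_zero _ (ENNReal.ofReal_pos.2 (by positivity)).ne') hv₁'
  refine ⟨c₀ / c₁, ENNReal.div_ne_zero.2 ⟨hc₀, hc₁⟩, fun r hr hr1 A hA => ?_⟩
  suffices h : P (π ⁻¹' A) * c₀ ≤ ENNReal.ofReal r ^ t * c₁ by
    rw [div_eq_mul_inv, mul_right_comm, ← div_eq_mul_inv, mul_comm c₀]
    exact ENNReal.div_le_of_le_mul h
  rcases A.eq_empty_or_nonempty with rfl | ⟨a, ha⟩
  · simp
  have hrd0 : ENNReal.ofReal r ^ d ≠ 0 := pow_ne_zero _ (ENNReal.ofReal_pos.2 hr).ne'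
  have hrdt : ENNReal.ofReal r ^ d ≠ ∞ := ENNReal.pow_ne_top ENNReal.ofReal_ne_top
  set T := {τ ∈ Φ.cutSet z r | (wordMap Φ.φ τ '' Φ.X ∩ A).Nonempty}
  have hcover : π ⁻¹' A ⊆ ⋃ τ ∈ T, {ω | initialWord ω τ.length = τ} := by
    intro ω hω
    obtain ⟨n, hn⟩ := Φ.exists_initialWord_mem_cutSet hs0 hs hΦ hz hr ω
    refine mem_biUnion (x := initialWord ω n) ⟨hn, π ω, hπ ω n, hω⟩ ?_
    simp [length_initialWord]
  have hmass (τ : T) : P {ω | initialWord ω τ.1.length = τ} ≤ ENNReal.ofReal r ^ t := by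
    rcases eq_empty_or_nonempty {ω | initialWord ω τ.1.length = τ.1} with h | ⟨ω, hω⟩
    · rw [h, measure_empty]
      exact zero_le
    · have h1 := hP ω τ.1.length
      rw [show initialWord ω τ.1.length = τ from hω] at h1
      exact h1.trans (ENNReal.rpow_le_rpow (ENNReal.ofReal_le_ofReal τ.2.1.1) ht)
  have hvol (τ : T) : ENNReal.ofReal r ^ d * c₀ ≤ volume (wordMap Φ.φ τ.1 '' interior Φ.X) := by
    refine le_trans ?_ (hK.le_volume_image τ.1 hzV)
    rw [← mul_assoc, ← mul_pow, ← ENNReal.ofReal_mul hr.le]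
    gcongr
    rw [← mul_div_assoc]
    gcongr
    exact hK.le_derivAt_of_mem_cutSet hzV hr1 hm0 hi₀ τ.2.1
  have hball : ⋃ τ ∈ T, wordMap Φ.φ τ '' interior Φ.X ⊆ Metric.closedBall a (r * (1 + C)) := by
    refine iUnion₂_subset fun τ hτ => ?_
    rintro _ ⟨x, hx, rfl⟩
    obtain ⟨_, ⟨y, hy, rfl⟩, hyA⟩ := hτ.2
    have h1 : dist (wordMap Φ.φ τ x) (wordMap Φ.φ τ y) ≤ C * r :=
      (hdist τ z hzV x (interior_subset hx) y hy).trans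
        (mul_le_mul_of_nonneg_left hτ.1.1 hC)
    have h2 : dist (wordMap Φ.φ τ y) a ≤ r := by
      have := (Metric.edist_le_ediam_of_mem hyA ha).trans hA
      rwa [edist_dist, ENNReal.ofReal_le_ofReal_iff hr.le] at this
    rw [Metric.mem_closedBall]
    have h3 := dist_triangle (wordMap Φ.φ τ x) (wordMap Φ.φ τ y) a
    linarith
  have hdisj : T.PairwiseDisjoint fun τ => wordMap Φ.φ τ '' interior Φ.X :=
    fun σ hσ τ hτ hne => Φ.disjoint_image_interior
      (Φ.not_prefix_of_mem_cutSet hσ.1 hτ.1 hne) (Φ.not_prefix_of_mem_cutSet hτ.1 hσ.1 hne.symm)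
  have hsum : P (π ⁻¹' A) * (ENNReal.ofReal r ^ d * c₀) ≤
      ENNReal.ofReal r ^ t * c₁ * ENNReal.ofReal r ^ d :=
    calc P (π ⁻¹' A) * (ENNReal.ofReal r ^ d * c₀)
        ≤ (∑' τ : T, P {ω | initialWord ω τ.1.length = τ}) * (ENNReal.ofReal r ^ d * c₀) := by
          gcongr
          exact (measure_mono hcover).trans (measure_biUnion_le P T.to_countable _)
      _ = ∑' τ : T, P {ω | initialWord ω τ.1.length = τ} * (ENNReal.ofReal r ^ d * c₀) :=
          ENNReal.tsum_mul_right.symm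
      _ ≤ ∑' τ : T, ENNReal.ofReal r ^ t * volume (wordMap Φ.φ τ.1 '' interior Φ.X) :=
          ENNReal.tsum_le_tsum fun τ => mul_le_mul' (hmass τ) (hvol τ)
      _ = ENNReal.ofReal r ^ t * volume (⋃ τ ∈ T, wordMap Φ.φ τ '' interior Φ.X) := by
          rw [ENNReal.tsum_mul_left, measure_biUnion T.to_countable hdisj
            fun τ _ => Φ.measurableSet_image_interior τ]
      _ ≤ ENNReal.ofReal r ^ t * volume (Metric.closedBall a (r * (1 + C))) := by gcongr
      _ = ENNReal.ofReal r ^ t * c₁ * ENNReal.ofReal r ^ d := by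
          rw [Measure.addHaar_closedBall volume a (by positivity), finrank_euclideanSpace_fin,
            ENNReal.ofReal_pow (by positivity), ENNReal.ofReal_mul hr.le, mul_pow]
          ring
  rw [mul_comm (ENNReal.ofReal r ^ d), ← mul_assoc] at hsum
  exact (ENNReal.mul_le_mul_iff_left hrd0 hrdt).1 hsum

/-- The dimension of the limit set of a finite system is at least `t` once the weights
`(|φ_i'(z)| / K) ^ t` sum to at least `1`, by the mass distribution principle for a Bernoulli
measure with smaller weights. -/
theorem HasDistortion.le_dimH_limitSet [NeZero d] [Fintype I] {K s : ℝ} {Φ : ConformalIFS d I}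
    (hK : Φ.HasDistortion K) (hs0 : 0 ≤ s) (hs : s < 1) (hΦ : Φ.ContractingBy s)
    {z : EuclideanSpace ℝ (Fin d)} (hz : z ∈ Φ.X) {t : ℝ≥0}
    (ht : 1 ≤ ∑ i, ENNReal.ofReal (Φ.derivAt [i] z / K) ^ (t : ℝ)) :
    t ≤ dimH Φ.limitSet := by
  have : Nonempty I := by
    by_contra h
    rw [not_nonempty_iff] at h
    simp at ht
  let _ : MeasurableSpace I := ⊤
  have : MeasurableSingletonClass I := ⟨fun _ => trivial⟩
  obtain ⟨P, hPprob, hP⟩ := exists_measure_cylinder_le _ ht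
    fun i => ENNReal.rpow_ne_top_of_nonneg t.coe_nonneg ENNReal.ofReal_ne_top
  obtain ⟨π, hπm, hπ⟩ := Φ.exists_measurable_coding hs0 hs hΦ
  obtain ⟨c, hc, hfrost⟩ := hK.exists_frostman hs0 hs hΦ hz t.coe_nonneg
    (fun ω n => (hP ω n).trans
      (hK.prod_le_derivAt_initialWord (Φ.X_subset_V hz) t.coe_nonneg ω n)) hπ
  have hle : c • P.map π ≤ μH[(t : ℝ)] := by
    refine Measure.le_hausdorffMeasure _ _ 2⁻¹ (by simp) fun A hA => ?_
    have hAt : Metric.ediam A ≠ ∞ := ne_top_of_le_ne_top (by simp) hA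
    have hA1 : (Metric.ediam A).toReal < 1 :=
      ((ENNReal.toReal_le_toReal hAt (by simp)).2 hA).trans_lt (by norm_num)
    have hlim : Tendsto (fun r : ℝ => ENNReal.ofReal r ^ (t : ℝ))
        (𝓝[>] (Metric.ediam A).toReal) (𝓝 (Metric.ediam A ^ (t : ℝ))) := by
      have h1 : Continuous fun r : ℝ => ENNReal.ofReal r ^ (t : ℝ) :=
        ENNReal.continuous_rpow_const.comp ENNReal.continuous_ofReal
      have h2 := h1.tendsto (Metric.ediam A).toReal
      rw [ENNReal.ofReal_toReal hAt] at h2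
      exact h2.mono_left nhdsWithin_le_nhds
    refine ge_of_tendsto hlim ?_
    filter_upwards [Ioo_mem_nhdsGT hA1] with r hr
    -- The closure of `A` has the same diameter and is measurable.
    calc (c • P.map π) A ≤ (c • P.map π) (closure A) := measure_mono subset_closure
      _ = c * P (π ⁻¹' closure A) := by
        rw [Measure.smul_apply, Measure.map_apply hπm isClosed_closure.measurableSet, smul_eq_mul]
      _ ≤ _ := hfrost r (ENNReal.toReal_nonneg.trans_lt hr.1) hr.2 _ (by
        rw [Metric.ediam_closure]
        exact ENNReal.le_ofReal_iff_toReal_le hAt (ENNReal.toReal_nonneg.trans hr.1.le) |>.2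
          hr.1.le)
  refine le_dimH_of_hausdorffMeasure_ne_zero (ne_of_gt (lt_of_lt_of_le ?_ (hle _)))
  have hpre : π ⁻¹' Φ.limitSet = univ :=
    eq_univ_of_forall fun ω => mem_iUnion.2 ⟨ω, mem_iInter.2 fun n => hπ ω n⟩
  rw [Measure.smul_apply, smul_eq_mul]
  refine ENNReal.mul_pos hc (ne_of_gt (lt_of_lt_of_le ?_
    (Measure.le_map_apply hπm.aemeasurable _)))
  rw [hpre, measure_univ]
  exact zero_lt_one

/-! ### Approximation by finite subsystems -/

/-- Once some partition function of a finite system exceeds a distortion constant, the iterated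
system satisfies the criterion for the lower bound of the dimension. -/
theorem HasDistortion.le_dimH_of_le_partitionFunction [NeZero d] [Finite I] {K s : ℝ}
    {Φ : ConformalIFS d I} (hK : Φ.HasDistortion K) (hs0 : 0 ≤ s) (hs : s < 1)
    (hΦ : Φ.ContractingBy s) {t : ℝ≥0} {n : ℕ} (hn : 0 < n)
    (h : ENNReal.ofReal (K * K) ^ (t : ℝ) ≤ Φ.partitionFunction n t) :
    t ≤ dimH Φ.limitSet := by
  have hK0 : 0 < K := zero_lt_one.trans_le hK.1
  obtain ⟨z, hz⟩ := Φ.nonempty_X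
  have := Fintype.ofFinite I
  refine le_trans ?_ (dimH_mono (Φ.limitSet_iterate_subset hn))
  refine (hK.iterate n).le_dimH_limitSet (pow_nonneg hs0 n) (pow_lt_one₀ hs0 hs hn.ne')
    (hΦ.iterate hs0 n) (z := z) hz ?_
  have hder (ω : Fin n → I) : (Φ.iterate n).derivAt [ω] z = Φ.derivAt (List.ofFn ω) z := by
    rw [derivAt, wordMap_iterate, derivAt]
    simp
  have hKK : ENNReal.ofReal (K * K) ^ (t : ℝ) ≠ 0 :=
    (ENNReal.rpow_pos (ENNReal.ofReal_pos.2 (by positivity)) ENNReal.ofReal_ne_top).ne'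
  have hKK' : ENNReal.ofReal (K * K) ^ (t : ℝ) ≠ ∞ :=
    ENNReal.rpow_ne_top_of_nonneg t.coe_nonneg ENNReal.ofReal_ne_top
  refine (ENNReal.mul_le_mul_iff_right hKK hKK').1 ?_
  rw [mul_one, Finset.mul_sum]
  refine h.trans ?_
  rw [partitionFunction, tsum_fintype]
  refine Finset.sum_le_sum fun ω _ => ?_
  rw [hder, ← ENNReal.mul_rpow_of_nonneg _ _ t.coe_nonneg,
    ← ENNReal.ofReal_mul (by positivity)]
  refine ENNReal.rpow_le_rpow ((hK.derivNorm_le _ (Φ.X_subset_V hz)).trans_eq ?_) t.coe_nonneg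
  congr 1
  field_simp

theorem ContractingBy.partitionFunction_le [NeZero d] {s : ℝ} (hs0 : 0 ≤ s)
    {Φ : ConformalIFS d I} (hΦ : Φ.ContractingBy s) {t u : ℝ≥0} (htu : t ≤ u) (n : ℕ) :
    Φ.partitionFunction n u ≤
      Φ.partitionFunction n t * (ENNReal.ofReal s ^ ((u : ℝ) - t)) ^ n := by
  have htu' : (0 : ℝ) ≤ (u : ℝ) - t := sub_nonneg.2 htu
  rw [partitionFunction, partitionFunction, ← ENNReal.tsum_mul_right]
  refine ENNReal.tsum_le_tsum fun ω => ?_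
  calc Φ.derivNorm (List.ofFn ω) ^ (u : ℝ)
      = Φ.derivNorm (List.ofFn ω) ^ (t : ℝ) * Φ.derivNorm (List.ofFn ω) ^ ((u : ℝ) - t) := by
        rw [← ENNReal.rpow_add_of_nonneg _ _ t.coe_nonneg htu', add_sub_cancel]
    _ ≤ Φ.derivNorm (List.ofFn ω) ^ (t : ℝ) * (ENNReal.ofReal s ^ n) ^ ((u : ℝ) - t) := by
        gcongr
        simpa only [List.length_ofFn] using hΦ.derivNorm_le hs0 (List.ofFn ω)
    _ = _ := by
        rw [← ENNReal.rpow_natCast, ← ENNReal.rpow_natCast, ← ENNReal.rpow_mul,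
          ← ENNReal.rpow_mul, mul_comm (n : ℝ)]

/-- If the limit sets of all finite subsystems have dimension less than `t`, all partition
functions at `t` are bounded, and the pressure is negative at every larger exponent. -/
theorem ContractingBy.pressure_neg_of_dimH_subsystem_lt [NeZero d] {s : ℝ} (hs0 : 0 ≤ s)
    (hs : s < 1) {Φ : ConformalIFS d I} (hΦ : Φ.ContractingBy s) {t u : ℝ≥0} (htu : t < u)
    (ht : ∀ F : Finset I, dimH (Φ.subsystem (F : Set I)).limitSet < t) : Φ.pressure u < 0 := by
  obtain ⟨K, hK⟩ := Φ.exists_hasDistortion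
  have hbound (n : ℕ) (hn : 0 < n) :
      Φ.partitionFunction n t ≤ ENNReal.ofReal (K * K) ^ (t : ℝ) := by
    by_contra! h
    obtain ⟨F, hF⟩ := Φ.exists_lt_partitionFunction_subsystem h
    exact ((hK.subsystem (F : Set I)).le_dimH_of_le_partitionFunction hs0 hs
      (hΦ.subsystem (F : Set I)) hn hF.le).not_gt (ht F)
  refine Φ.pressure_neg_of_partitionFunction_le (M := ENNReal.ofReal (K * K) ^ (t : ℝ))
    (q := ENNReal.ofReal s ^ ((u : ℝ) - t))
    (ENNReal.rpow_ne_top_of_nonneg t.coe_nonneg ENNReal.ofReal_ne_top)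
    (ENNReal.rpow_lt_one (ENNReal.ofReal_lt_one.2 hs) (sub_pos.2 htu)) ?_
  filter_upwards [eventually_ge_atTop 1] with n hn
  refine (hΦ.partitionFunction_le hs0 htu.le n).trans ?_
  gcongr
  exact hbound n hn

theorem ContractingBy.mono {s s' : ℝ} {Φ : ConformalIFS d I} (hΦ : Φ.ContractingBy s)
    (h : s ≤ s') : Φ.ContractingBy s' := fun i x hx => (hΦ i x hx).trans h

end ConformalIFS

theorem mainTheorem8 {d : ℕ} (hd : 1 ≤ d) {I : Type*} [Countable I] (Φ : ConformalIFS d I)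
    {s : ℝ} (hs : s < 1) (hΦ : Φ.ContractingBy s) :
    dimH Φ.limitSet = ⨅ (δ : ℝ≥0) (_ : Φ.pressure δ < 0), (δ : ℝ≥0∞) ∧
    dimH Φ.limitSet = ⨆ F : Finset I, dimH (Φ.subsystem (F : Set I)).limitSet := by
  have : NeZero d := ⟨by omega⟩
  -- A negative bound `s` is possible for empty `I`.
  have hs0 : (0 : ℝ) ≤ max s 0 := le_max_right _ _
  have hs1 : max s 0 < 1 := max_lt hs zero_lt_one
  replace hΦ : Φ.ContractingBy (max s 0) := hΦ.mono (le_max_left _ _)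
  have h1 : dimH Φ.limitSet ≤ ⨅ (δ : ℝ≥0) (_ : Φ.pressure δ < 0), (δ : ℝ≥0∞) :=
    le_iInf₂ fun δ hδ => Φ.dimH_limitSet_le_of_pressure_neg hs0 hs1 hΦ hδ
  have h2 : ⨆ F : Finset I, dimH (Φ.subsystem (F : Set I)).limitSet ≤ dimH Φ.limitSet :=
    iSup_le fun F => dimH_mono (Φ.limitSet_subsystem_subset _)
  have h3 : ⨅ (δ : ℝ≥0) (_ : Φ.pressure δ < 0), (δ : ℝ≥0∞) ≤
      ⨆ F : Finset I, dimH (Φ.subsystem (F : Set I)).limitSet := by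
    refine le_of_forall_gt fun c hc => ?_
    obtain ⟨t, hSt, htc⟩ := ENNReal.lt_iff_exists_nnreal_btwn.1 hc
    obtain ⟨u, htu, huc⟩ := ENNReal.lt_iff_exists_nnreal_btwn.1 htc
    refine lt_of_le_of_lt (iInf₂_le u ?_) huc
    exact hΦ.pressure_neg_of_dimH_subsystem_lt hs0 hs1 (ENNReal.coe_lt_coe.1 htu)
      fun F => lt_of_le_of_lt
        (le_iSup (fun F : Finset I => dimH (Φ.subsystem (F : Set I)).limitSet) F) hSt
  exact ⟨le_antisymm h1 (h3.trans h2), le_antisymm (h1.trans h3) h2⟩
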